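/- \textbf{Theorem.} Let $X$ be a countably infinite simple graph of bounded degree with vertex set $V$, let $\Gamma$ be an amenable group of automorphisms of $X$ acting freely on $V$ with finitely many orbits, and let $F\subset V$ be a (finite) set of representatives of the orbits. Let $A$ be the adjacency operator of $X$ on $\ell^2(V)$, let $\mathcal N(X,\Gamma)$ be the von Neumann algebra of all bounded operators on $\ell^2(V)$ commuting with the unitaries $(\lambda(\gamma)f)(x)=f(\gamma^{-1}x)$, $\gamma\in\Gamma$, with its trace $\mathrm{Tr}_\Gamma(T)=\sum_{x\in F}\langle\delta_x,T\delta_x\rangle$, and let $\pi$ be the trace representation of $\mathcal N(X,\Gamma)$, i.e. the GNS representation associated with $\mathrm{Tr}_\Gamma$. Then $$\|A\|=\sup\sigma(\pi(A))=\|\pi(A)\|,$$ and $H:=\|A\|-A$ does not have hidden spectrum. The latter means the following. Let $(\Lambda_n)$ be any amenable exhaustion of $X$, i.e. an increasing sequence of finite sets of vertices with union $V$ such that $$\frac{|\{v\in\Lambda_n: v\text{ is adjacent to a vertex outside }\Lambda_n\}|}{|\Lambda_n|}\to0.$$ Let $P_n$ be the projection onto $\ell^2(\Lambda_n)$, let $H_n=P_nHP_n$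 acting on $\ell^2(\Lambda_n)$, and let $N_{H_n}(t)$ be $|\Lambda_n|^{-1}$ times the number of eigenvalues of $H_n$ (with multiplicity) that are at most $t$. Let $N_H(t)=\mathrm{Tr}_\Gamma(E_H[0,t])$, where $E_H$ is the spectral measure of $H$. Then the limit $E_0(H)=\lim_n\inf\operatorname{supp}(dN_{H_n})$ exists and equals $E_m(H)=\inf\operatorname{supp}(dN_H)$. -/

import Mathlib

open Filter Topology
open scoped InnerProductSpace ComplexOrder ENNReal

noncomputable section

namespace PeriodicGraph

variable {V : Type*}

/-! ### The Hilbert space of a vertex set -/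

/-- The complex Hilbert space `ℓ²(V)`. -/
abbrev Ell2 (V : Type*) : Type _ := lp (fun _ : V => ℂ) 2

open Classical in
/-- The canonical basis vector `δ_v` of `ℓ²(V)`. -/
def delta (v : V) : Ell2 V := lp.single 2 v (1 : ℂ)

lemma norm_sq_eq_tsum (f : Ell2 V) : ‖f‖ ^ 2 = ∑' v, ‖f v‖ ^ 2 := by
  have h := lp.norm_rpow_eq_tsum (p := 2) (by norm_num) f
  simpa using h

lemma summable_norm_sq (f : Ell2 V) : Summable fun v => ‖f v‖ ^ 2 := by
  have h := (lp.memℓp f).summable (p := 2) (by norm_num)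
  simpa using h

lemma memlp_of_sum_le {f : V → ℂ} {C : ℝ} (h : ∀ s : Finset V, ∑ v ∈ s, ‖f v‖ ^ 2 ≤ C) :
    Memℓp f 2 := by
  refine memℓp_gen' (C := C) fun s => ?_
  simpa using h s

/-! ### The adjacency operator -/

/-- Bounded degree: some `d` bounds the number of neighbours of every vertex. -/
def BoundedDegree (X : SimpleGraph V) : Prop :=
  ∃ d : ℕ, ∀ v, (X.neighborSet v).encard ≤ d

open Classical in
/-- The entries of the adjacency matrix. -/
def adjEntry (X : SimpleGraph V) (v w : V) : ℂ := if X.Adj v w then 1 else 0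

/-- The adjacency matrix applied to a function (for bounded degree the sum is finite). -/
def adjApply (X : SimpleGraph V) (f : V → ℂ) (v : V) : ℂ := ∑' w, adjEntry X v w * f w

lemma BoundedDegree.finite {X : SimpleGraph V} (hX : BoundedDegree X) (v : V) :
    (X.neighborSet v).Finite := by
  obtain ⟨d, hd⟩ := hX
  exact Set.finite_of_encard_le_coe (hd v)

lemma adjApply_eq {X : SimpleGraph V} (hX : BoundedDegree X) (f : V → ℂ) (v : V) :
    adjApply X f v = ∑ w ∈ (hX.finite v).toFinset, f w := by
  rw [adjApply, tsum_eq_sum (s := (hX.finite v).toFinset)]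
  · refine Finset.sum_congr rfl fun w hw => ?_
    have : X.Adj v w := by simpa using hw
    simp [adjEntry, this]
  · intro w hw
    have : ¬ X.Adj v w := by simpa using hw
    simp [adjEntry, this]

lemma sum_adjApply_le {X : SimpleGraph V} (hX : BoundedDegree X) {d : ℕ}
    (hd : ∀ v, (X.neighborSet v).encard ≤ d) (f : Ell2 V) (s : Finset V) :
    ∑ v ∈ s, ‖adjApply X f v‖ ^ 2 ≤ ((d : ℝ) * ‖f‖) ^ 2 := by
  classical
  have hcard : ∀ v, ((hX.finite v).toFinset.card : ℝ) ≤ d := by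
    intro v
    have h := hd v
    rw [(hX.finite v).encard_eq_coe_toFinset_card] at h
    exact_mod_cast h
  have h1 : ∀ v, ‖adjApply X f v‖ ^ 2 ≤ d * ∑ w ∈ (hX.finite v).toFinset, ‖f w‖ ^ 2 := by
    intro v
    rw [adjApply_eq hX]
    calc ‖∑ w ∈ (hX.finite v).toFinset, f w‖ ^ 2
        ≤ (∑ w ∈ (hX.finite v).toFinset, ‖f w‖) ^ 2 := by
          gcongr
          exact norm_sum_le _ _
      _ ≤ (hX.finite v).toFinset.card * ∑ w ∈ (hX.finite v).toFinset, ‖f w‖ ^ 2 :=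
          sq_sum_le_card_mul_sum_sq
      _ ≤ d * ∑ w ∈ (hX.finite v).toFinset, ‖f w‖ ^ 2 := by
          gcongr
          exact_mod_cast hcard v
  set t : Finset V := s.biUnion fun v => (hX.finite v).toFinset with ht
  have h2 : ∑ v ∈ s, ∑ w ∈ (hX.finite v).toFinset, ‖f w‖ ^ 2 ≤ d * ∑ w ∈ t, ‖f w‖ ^ 2 := by
    have : ∀ v ∈ s, ∑ w ∈ (hX.finite v).toFinset, ‖f w‖ ^ 2
        = ∑ w ∈ t, if X.Adj v w then ‖f w‖ ^ 2 else 0 := by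
      intro v hv
      rw [← Finset.sum_filter]
      refine Finset.sum_congr ?_ fun _ _ => rfl
      ext w
      simp only [Set.Finite.mem_toFinset, SimpleGraph.mem_neighborSet, Finset.mem_filter, ht,
        Finset.mem_biUnion]
      exact ⟨fun h => ⟨⟨v, hv, h⟩, h⟩, fun h => h.2⟩
    rw [Finset.sum_congr rfl this, Finset.sum_comm, Finset.mul_sum]
    refine Finset.sum_le_sum fun w _ => ?_
    rw [← Finset.sum_filter, Finset.sum_const, nsmul_eq_mul]
    gcongr
    have : (s.filter fun v => X.Adj v w) ⊆ (hX.finite w).toFinset := by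
      intro v hv
      simpa using (Finset.mem_filter.1 hv).2.symm
    exact (Finset.card_le_card this).trans (by exact_mod_cast hcard w)
  have h3 : ∑ w ∈ t, ‖f w‖ ^ 2 ≤ ‖f‖ ^ 2 := by
    rw [norm_sq_eq_tsum]
    exact (summable_norm_sq f).sum_le_tsum _ fun _ _ => by positivity
  calc ∑ v ∈ s, ‖adjApply X f v‖ ^ 2
      ≤ ∑ v ∈ s, d * ∑ w ∈ (hX.finite v).toFinset, ‖f w‖ ^ 2 :=
        Finset.sum_le_sum fun v _ => h1 v
    _ = d * ∑ v ∈ s, ∑ w ∈ (hX.finite v).toFinset, ‖f w‖ ^ 2 := by rw [Finset.mul_sum]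
    _ ≤ d * (d * ‖f‖ ^ 2) := by gcongr; exact h2.trans (by gcongr)
    _ = ((d : ℝ) * ‖f‖) ^ 2 := by ring

lemma memlp_adjApply {X : SimpleGraph V} (hX : BoundedDegree X) (f : Ell2 V) :
    Memℓp (adjApply X f) 2 := by
  obtain ⟨d, hd⟩ := id hX
  exact memlp_of_sum_le (sum_adjApply_le hX hd f)

/-- The adjacency operator as a linear map: `(A f)(v) = ∑_w A(v, w) f(w)`. -/
def adjLinear (X : SimpleGraph V) (hX : BoundedDegree X) : Ell2 V →ₗ[ℂ] Ell2 V where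
  toFun f := ⟨adjApply X f, memlp_adjApply hX f⟩
  map_add' f g := by
    ext v
    change adjApply X (f + g : Ell2 V) v = adjApply X f v + adjApply X g v
    simp only [adjApply_eq hX, lp.coeFn_add, Pi.add_apply, Finset.sum_add_distrib]
  map_smul' c f := by
    ext v
    change adjApply X (c • f : Ell2 V) v = c * adjApply X f v
    simp only [adjApply_eq hX, lp.coeFn_smul, Pi.smul_apply, smul_eq_mul, Finset.mul_sum]

/-- The adjacency operator `A` of a graph of bounded degree, as a bounded operator on `ℓ²(V)`. -/
def adjOp (X : SimpleGraph V) (hX : BoundedDegree X) : Ell2 V →L[ℂ] Ell2 V :=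
  LinearMap.mkContinuousOfExistsBound (adjLinear X hX) <| by
    obtain ⟨d, hd⟩ := id hX
    refine ⟨d, fun f => ?_⟩
    refine lp.norm_le_of_forall_sum_le (p := 2) (by norm_num) (by positivity) fun s => ?_
    have h := sum_adjApply_le hX hd f s
    simp only [ENNReal.toReal_ofNat, Real.rpow_ofNat]
    exact h

lemma adjOp_apply (X : SimpleGraph V) (hX : BoundedDegree X) (f : Ell2 V) (v : V) :
    adjOp X hX f v = ∑' w, adjEntry X v w * f w := rfl

/-! ### The group action, its von Neumann algebra and its trace -/

lemma memlp_comp (e : V ≃ V) (f : Ell2 V) : Memℓp (fun v => f (e v)) 2 := by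
  refine memℓp_gen ?_
  have h := (e.summable_iff).2 (summable_norm_sq f)
  simpa [Function.comp_def] using h

/-- The unitary operator `f ↦ f ∘ e⁻¹` on `ℓ²(V)` given by a permutation `e` of `V`. -/
def permOp (e : V ≃ V) : Ell2 V ≃ₗᵢ[ℂ] Ell2 V where
  toFun f := ⟨fun v => f (e.symm v), memlp_comp e.symm f⟩
  invFun f := ⟨fun v => f (e v), memlp_comp e f⟩
  map_add' _ _ := rfl
  map_smul' _ _ := rfl
  left_inv f := by ext v; simp
  right_inv f := by ext v; simp
  norm_map' f := by
    refine (sq_eq_sq₀ (norm_nonneg _) (norm_nonneg _)).1 ?_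
    rw [norm_sq_eq_tsum, norm_sq_eq_tsum]
    exact e.symm.tsum_eq fun v => ‖f v‖ ^ 2

/-- The representation `λ` of graph automorphisms: `(λ(γ) f)(x) = f(γ⁻¹ x)`. -/
def lam {X : SimpleGraph V} (γ : X ≃g X) : Ell2 V →L[ℂ] Ell2 V :=
  ((permOp γ.toEquiv).toContinuousLinearEquiv : Ell2 V →L[ℂ] Ell2 V)

lemma lam_apply {X : SimpleGraph V} (γ : X ≃g X) (f : Ell2 V) (v : V) :
    lam γ f v = f (γ.symm v) := rfl

lemma star_lam {X : SimpleGraph V} (γ : X ≃g X) : star (lam γ) = lam γ⁻¹ := by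
  rw [ContinuousLinearMap.star_eq_adjoint]
  exact (permOp γ.toEquiv).adjoint_eq_symm

/-- The set of operators `λ(γ)`, `γ ∈ Γ`. -/
def lamSet {X : SimpleGraph V} (Γ : Subgroup (X ≃g X)) : Set (Ell2 V →L[ℂ] Ell2 V) :=
  lam '' (Γ : Set (X ≃g X))

/-- The von Neumann algebra `N(X, Γ) = {λ(γ) : γ ∈ Γ}'` of all bounded operators on `ℓ²(V)` which
commute with the action of `Γ`. -/
def vN {X : SimpleGraph V} (Γ : Subgroup (X ≃g X)) : VonNeumannAlgebra (Ell2 V) where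
  toStarSubalgebra := StarSubalgebra.centralizer ℂ (lamSet Γ)
  centralizer_centralizer' := Set.centralizer_centralizer_centralizer _

lemma mem_vN {X : SimpleGraph V} {Γ : Subgroup (X ≃g X)} {T : Ell2 V →L[ℂ] Ell2 V} :
    T ∈ (vN Γ).toStarSubalgebra ↔ ∀ γ ∈ Γ, lam γ * T = T * lam γ := by
  change T ∈ StarSubalgebra.centralizer ℂ (lamSet Γ) ↔ _
  rw [StarSubalgebra.mem_centralizer_iff]
  constructor
  · intro h γ hγ
    exact (h _ ⟨γ, hγ, rfl⟩).1
  · rintro h _ ⟨γ, hγ, rfl⟩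
    refine ⟨h γ hγ, ?_⟩
    rw [star_lam]
    exact h _ (Γ.inv_mem hγ)

/-- The operators of `N(X, Γ)` as a type. -/
abbrev N {X : SimpleGraph V} (Γ : Subgroup (X ≃g X)) : Type _ := (vN Γ).toStarSubalgebra

instance {X : SimpleGraph V} (Γ : Subgroup (X ≃g X)) : CStarAlgebra (N Γ) :=
  have : IsClosed ((vN Γ).toStarSubalgebra : Set (Ell2 V →L[ℂ] Ell2 V)) :=
    Set.isClosed_centralizer _
  StarSubalgebra.cstarAlgebra _ (h_closed := this)

/-- The usual order of a C⋆-algebra: `a ≤ b` if `b - a` is self-adjoint with spectrum in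
`[0, ∞)`. -/
instance {X : SimpleGraph V} (Γ : Subgroup (X ≃g X)) : PartialOrder (N Γ) :=
  CStarAlgebra.spectralOrder _

instance {X : SimpleGraph V} (Γ : Subgroup (X ≃g X)) : StarOrderedRing (N Γ) :=
  CStarAlgebra.spectralOrderedRing _

/-- `A` belongs to `N(X, Γ)`. -/
lemma adjOp_mem {X : SimpleGraph V} (hX : BoundedDegree X) (Γ : Subgroup (X ≃g X)) :
    adjOp X hX ∈ (vN Γ).toStarSubalgebra := by
  rw [mem_vN]
  intro γ _
  ext f v
  change adjApply X f (γ.symm v) = adjApply X (lam γ f) v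
  simp only [adjApply]
  rw [← γ.toEquiv.symm.tsum_eq]
  refine tsum_congr fun w => ?_
  congr 1
  have : X.Adj (γ.symm v) (γ.symm w) ↔ X.Adj v w := γ.symm.map_adj_iff
  classical
  simp only [adjEntry]
  exact if_congr this rfl rfl

/-- `A` as an element of `N(X, Γ)`. -/
def adjN {X : SimpleGraph V} (hX : BoundedDegree X) (Γ : Subgroup (X ≃g X)) : N Γ :=
  ⟨adjOp X hX, adjOp_mem hX Γ⟩

/-- The action of `Γ` on the vertices is free. -/
def ActsFreely {X : SimpleGraph V} (Γ : Subgroup (X ≃g X)) : Prop :=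
  ∀ γ ∈ Γ, ∀ v : V, γ v = v → γ = 1

/-- `F` is a fundamental domain: it contains exactly one vertex of every orbit of `Γ`. A finite
fundamental domain exists if and only if the quotient is finite. -/
def IsFundamentalDomain {X : SimpleGraph V} (Γ : Subgroup (X ≃g X)) (F : Finset V) : Prop :=
  ∀ v : V, ∃! x : V, x ∈ F ∧ ∃ γ ∈ Γ, γ x = v

/-- A (discrete) group is amenable if it carries a left-invariant finitely additive probability
measure defined on all its subsets. -/
def IsAmenableGroup (G : Type*) [Group G] : Prop :=
  ∃ m : Set G → ℝ, (∀ S, 0 ≤ m S) ∧ m Set.univ = 1 ∧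
    (∀ S T, Disjoint S T → m (S ∪ T) = m S + m T) ∧
    ∀ (g : G) (S : Set G), m ((fun h => g * h) '' S) = m S

/-- The sum `∑_{x ∈ F} T(x, x)` of diagonal matrix entries. -/
def diagSum (F : Finset V) (T : Ell2 V →L[ℂ] Ell2 V) : ℂ :=
  ∑ x ∈ F, ⟪delta x, T (delta x)⟫_ℂ

/-- The trace `Tr_Γ(T) = ∑_{x ∈ F} T(x, x)` as a positive linear functional on `N(X, Γ)`. -/
def trace {X : SimpleGraph V} (Γ : Subgroup (X ≃g X)) (F : Finset V) : N Γ →ₚ[ℂ] ℂ :=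
  PositiveLinearMap.mk₀
    { toFun := fun T => diagSum F T.1
      map_add' := fun S T => by simp [diagSum, Finset.sum_add_distrib]
      map_smul' := fun c T => by simp [diagSum, Finset.mul_sum] }
    (by
      intro T hT
      obtain ⟨S, rfl⟩ := CStarAlgebra.nonneg_iff_eq_star_mul_self.1 hT
      refine Finset.sum_nonneg fun x _ => ?_
      change 0 ≤ ⟪delta x, (star S.1 * S.1) (delta x)⟫_ℂ
      rw [ContinuousLinearMap.star_eq_adjoint, mul_apply_eq_comp,
        ContinuousLinearMap.adjoint_inner_right]
      rw [inner_self_eq_norm_sq_to_K]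
      exact Complex.zero_le_real.2 (sq_nonneg ‖S.1 (delta x)‖) |>.trans_eq (by simp))

/-- The trace representation: the GNS representation `π` of `N(X, Γ)` given by `Tr_Γ`. -/
def traceRep {X : SimpleGraph V} (Γ : Subgroup (X ≃g X)) (F : Finset V) :
    N Γ →⋆ₐ[ℂ] ((trace Γ F).GNS →L[ℂ] (trace Γ F).GNS) :=
  (trace Γ F).gnsStarAlgHom

/-! ### Densities of states and hidden spectrum -/

/-- The spectral projection `E((-∞, t])` of a self-adjoint bounded operator `T`: the orthogonal
projection onto the kernel of the positive part `(T - t)⁺`, since `s ↦ max (s - t) 0` vanishes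
exactly on `(-∞, t]`. For `T ≥ 0` it is `E([0, t])`. -/
def spectralProj {K : Type*} [NormedAddCommGroup K] [InnerProductSpace ℂ K] [CompleteSpace K]
    (T : K →L[ℂ] K) (t : ℝ) : K →L[ℂ] K :=
  (cfc (fun s : ℝ => max (s - t) 0) T).ker.starProjection

/-- The integrated density of states `N_H(t) = Tr_Γ(E[0, t])` of a positive `H ∈ N(X, Γ)`. -/
def density (F : Finset V) (H : Ell2 V →L[ℂ] Ell2 V) (t : ℝ) : ℝ :=
  (diagSum F (spectralProj H t)).re

/-- The inclusion `ℓ²(Λ) → ℓ²(V)` for a finite set `Λ` of vertices. -/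
def incl (Λ : Finset V) : EuclideanSpace ℂ Λ →L[ℂ] Ell2 V :=
  ∑ x : Λ, (EuclideanSpace.proj x : EuclideanSpace ℂ Λ →L[ℂ] ℂ).smulRight (delta (x : V))

/-- The finite volume truncation `H_Λ = P_Λ H P_Λ`, as an operator on `ℓ²(Λ)`. -/
def truncation (H : Ell2 V →L[ℂ] Ell2 V) (Λ : Finset V) :
    EuclideanSpace ℂ Λ →L[ℂ] EuclideanSpace ℂ Λ :=
  (ContinuousLinearMap.adjoint (incl Λ)).comp (H.comp (incl Λ))

/-- The finite volume density of states
`N_{H_Λ}(t) = |Λ|⁻¹ Tr(E_{H_Λ}[0, t])`, that is `|Λ|⁻¹` times the number of eigenvalues of `H_Λ`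
(with multiplicity) which are at most `t`. -/
def finiteDensity (H : Ell2 V →L[ℂ] Ell2 V) (Λ : Finset V) (t : ℝ) : ℝ :=
  (LinearMap.trace ℂ (EuclideanSpace ℂ Λ) (spectralProj (truncation H Λ) t).toLinearMap).re /
    (Λ.card : ℝ)

/-- The support of the measure `dD` with nondecreasing distribution function `D`, that is the set
of points of increase of `D`. -/
def distSupport (D : ℝ → ℝ) : Set ℝ :=
  {t | ∀ ε > 0, D (t - ε) < D (t + ε)}

/-- `Λ` is the sequence of vertex sets of an amenable exhaustion of `X`: it is increasing, exhausts
`X`, and the vertices of `Λ n` at distance one from the complement of `Λ n` have density tending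
to zero. -/
structure IsAmenableExhaustion (X : SimpleGraph V) (Λ : ℕ → Finset V) : Prop where
  mono : Monotone Λ
  exhausts : ∀ v, ∃ n, v ∈ Λ n
  frontier : Tendsto
    (fun n => ({v | v ∈ Λ n ∧ ∃ w, w ∉ Λ n ∧ X.Adj v w} : Set V).ncard / ((Λ n).card : ℝ))
    atTop (𝓝 0)

/-- `H` has no hidden spectrum with respect to the exhaustion `Λ`: the limit
`E₀(H) = lim_n inf supp N_{H_{Λ n}}` exists and equals `E_m(H) = inf supp N_H`. -/
def NoHiddenSpectrum (F : Finset V) (Λ : ℕ → Finset V) (H : Ell2 V →L[ℂ] Ell2 V) : Prop :=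
  ∃ E₀ : ℝ,
    Tendsto (fun n => sInf (distSupport (finiteDensity H (Λ n)))) atTop (𝓝 E₀) ∧
    IsGLB (distSupport (density F H)) E₀

end PeriodicGraph

end

noncomputable section

namespace PeriodicGraph

/-! ### Quadratic forms and the bottom of the spectrum -/

section Hilbert

variable {K : Type*} [NormedAddCommGroup K] [InnerProductSpace ℂ K]

/-! Everything reduces to the quadratic form `Re ⟪T f, f⟫`. Let `m` be the largest constant with `m
‖f‖² ≤ Re ⟪T f, f⟫`. The spectral projection of a self-adjoint `T` at `t` vanishes for `t < m` and
not for `t > m`. Hence any nonnegative distribution function that vanishes exactly where this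
projection does has `m` as the least point of its support (`isLeast_distSupport`). This applies to
`N_H`, because the trace is faithful on `N(X, Γ)`, and to the finite volume densities, because a
projection of trace zero is zero. So both bottoms are minima of forms: truncation restricts the form
to `ℓ²(Λ n)`, which can only raise the minimum, and cutting off a test vector for `H` shows that the
minima converge to `m`.

For the norm, `A` has nonnegative entries, so replacing `f` by `|f|` dominates the absolute value of
the form (`abs_reApplyInnerSelf_adjOp_le`). Thus the numerical radius, which is `‖A‖`, is attained
at the upper end of the spectrum. Faithfulness of the trace makes `π` injective, hence isometric and
spectrum preserving (`IsFundamentalDomain.traceRep_injective`). -/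

lemma reApplyInnerSelf_algebraMap (m : ℝ) (f : K) :
    (algebraMap ℝ (K →L[ℂ] K) m).reApplyInnerSelf f = m * ‖f‖ ^ 2 := by
  rw [ContinuousLinearMap.reApplyInnerSelf_apply, Algebra.algebraMap_eq_smul_one]
  change RCLike.re ⟪(m : ℂ) • f, f⟫_ℂ = _
  rw [inner_smul_left, inner_self_eq_norm_sq_to_K]
  simp [← Complex.ofReal_pow]

lemma reApplyInnerSelf_sub (S T : K →L[ℂ] K) (f : K) :
    (S - T).reApplyInnerSelf f = S.reApplyInnerSelf f - T.reApplyInnerSelf f := by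
  simp [ContinuousLinearMap.reApplyInnerSelf_apply, inner_sub_left]

lemma exists_isGreatest_lowerBound [Nontrivial K] (T : K →L[ℂ] K) :
    ∃ m, IsGreatest {t : ℝ | ∀ f, t * ‖f‖ ^ 2 ≤ T.reApplyInnerSelf f} m := by
  obtain ⟨g, hg⟩ := exists_ne (0 : K)
  have hg' : 0 < ‖g‖ ^ 2 := by positivity
  refine ⟨_, IsClosed.isGreatest_csSup ?_ ⟨-‖T‖, fun f => ?_⟩
    ⟨T.reApplyInnerSelf g / ‖g‖ ^ 2, fun t ht => (le_div_iff₀ hg').2 (ht g)⟩⟩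
  · simp only [Set.ofPred_forall]
    exact isClosed_iInter fun f => isClosed_le (by fun_prop) continuous_const
  · rw [ContinuousLinearMap.reApplyInnerSelf_apply]
    have h1 := (abs_le.1 (RCLike.abs_re_le_norm ⟪T f, f⟫_ℂ)).1
    have h2 := norm_inner_le_norm (𝕜 := ℂ) (T f) f
    have h3 := mul_le_mul_of_nonneg_right (T.le_opNorm f) (norm_nonneg f)
    nlinarith

variable [CompleteSpace K]

lemma le_iff_reApplyInnerSelf {S T : K →L[ℂ] K} (hS : IsSelfAdjoint S) (hT : IsSelfAdjoint T) :
    S ≤ T ↔ ∀ f, S.reApplyInnerSelf f ≤ T.reApplyInnerSelf f := by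
  rw [ContinuousLinearMap.le_def, ContinuousLinearMap.isPositive_def']
  simp only [hT.sub hS, true_and, reApplyInnerSelf_sub, sub_nonneg]

lemma algebraMap_le_iff_reApplyInnerSelf {T : K →L[ℂ] K} (hT : IsSelfAdjoint T) {m : ℝ} :
    algebraMap ℝ (K →L[ℂ] K) m ≤ T ↔ ∀ f, m * ‖f‖ ^ 2 ≤ T.reApplyInnerSelf f := by
  rw [le_iff_reApplyInnerSelf (.algebraMap _ (.all m)) hT]
  simp only [reApplyInnerSelf_algebraMap]

lemma le_algebraMap_iff_reApplyInnerSelf {T : K →L[ℂ] K} (hT : IsSelfAdjoint T) {m : ℝ} :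
    T ≤ algebraMap ℝ (K →L[ℂ] K) m ↔ ∀ f, T.reApplyInnerSelf f ≤ m * ‖f‖ ^ 2 := by
  rw [le_iff_reApplyInnerSelf hT (.algebraMap _ (.all m))]
  simp only [reApplyInnerSelf_algebraMap]

/-- On the spectrum, which lies in `[m, ∞)`, the positive part `(s - t)⁺` is just `s - t`, and `T -
t ≥ m - t > 0` has trivial kernel. -/
lemma spectralProj_eq_zero_of_lt {T : K →L[ℂ] K} (hT : IsSelfAdjoint T) {m t : ℝ}
    (hm : ∀ f, m * ‖f‖ ^ 2 ≤ T.reApplyInnerSelf f) (ht : t < m) : spectralProj T t = 0 := by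
  have hspec := (algebraMap_le_iff_le_spectrum (R := ℝ) hT).1
    ((algebraMap_le_iff_reApplyInnerSelf hT).2 hm)
  have hcfc : cfc (fun s : ℝ => max (s - t) 0) T = T - algebraMap ℝ (K →L[ℂ] K) t := by
    rw [cfc_congr (g := fun s => s - t) fun s hs => max_eq_left (by linarith [hspec s hs]),
      cfc_sub .., cfc_id' ℝ T, cfc_const t T]
  have hker : (T - algebraMap ℝ (K →L[ℂ] K) t).ker = ⊥ := by
    rw [LinearMap.ker_eq_bot']
    intro f hf
    have h1 : (T - algebraMap ℝ (K →L[ℂ] K) t).reApplyInnerSelf f = 0 := by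
      rw [ContinuousLinearMap.reApplyInnerSelf_apply]
      erw [hf]
      simp
    rw [reApplyInnerSelf_sub, reApplyInnerSelf_algebraMap] at h1
    have h2 := hm f
    have h3 : ‖f‖ ^ 2 = 0 := by nlinarith [sq_nonneg ‖f‖]
    simpa using h3
  rw [← hcfc] at hker
  simp [spectralProj, hker]

lemma le_reApplyInnerSelf_of_spectralProj_eq_zero {T : K →L[ℂ] K} (hT : IsSelfAdjoint T) {t : ℝ}
    (h : spectralProj T t = 0) (f : K) : t * ‖f‖ ^ 2 ≤ T.reApplyInnerSelf f := by
  revert f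
  rw [← algebraMap_le_iff_reApplyInnerSelf hT]
  have hmul : cfc (fun s : ℝ => max (s - t) 0) T * cfc (fun s : ℝ => max (t - s) 0) T = 0 := by
    rw [← cfc_mul .., ← cfc_zero ℝ T]
    refine cfc_congr fun s _ => ?_
    rcases le_total s t with hs | hs
    · simp [max_eq_right (sub_nonpos.2 hs)]
    · simp [max_eq_right (sub_nonpos.2 hs)]
  -- The range of `(T - t)⁻` lies in the kernel of `(T - t)⁺`, where the spectral projection is the
  -- identity; as that projection is zero, so is `(T - t)⁻`.
  have hneg : cfc (fun s : ℝ => max (t - s) 0) T = 0 := by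
    ext f
    set g := cfc (fun s : ℝ => max (t - s) 0) T f with hg
    have hmem : g ∈ (cfc (fun s : ℝ => max (s - t) 0) T).ker :=
      LinearMap.mem_ker.2 (DFunLike.congr_fun hmul f)
    have h1 := Submodule.starProjection_eq_self_iff.2 hmem
    rw [← h1]
    exact DFunLike.congr_fun h g
  rw [← sub_nonneg]
  have hsub : T - algebraMap ℝ (K →L[ℂ] K) t = cfc (fun s : ℝ => max (s - t) 0) T := by
    rw [← sub_zero (cfc (fun s : ℝ => max (s - t) 0) T), ← hneg, ← cfc_sub ..]
    rw [cfc_congr (g := fun s => s - t), cfc_sub .., cfc_id' ℝ T, cfc_const t T]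
    intro s _
    change max (s - t) 0 - max (t - s) 0 = s - t
    rcases le_total s t with hs | hs
    · rw [max_eq_right (by linarith), max_eq_left (by linarith)]; ring
    · rw [max_eq_left (by linarith), max_eq_right (by linarith)]; ring
  rw [hsub]
  exact cfc_nonneg fun s _ => le_max_right _ _

lemma mem_upperBounds_spectrum_iff {T : K →L[ℂ] K} (hT : IsSelfAdjoint T) {M : ℝ} :
    M ∈ upperBounds (spectrum ℝ T) ↔ ∀ f, T.reApplyInnerSelf f ≤ M * ‖f‖ ^ 2 := by
  rw [← le_algebraMap_iff_reApplyInnerSelf hT]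
  exact (le_algebraMap_iff_spectrum_le (R := ℝ) hT).symm

lemma norm_mem_upperBounds_spectrum {T : K →L[ℂ] K} (hT : IsSelfAdjoint T) :
    ‖T‖ ∈ upperBounds (spectrum ℝ T) :=
  (le_algebraMap_iff_spectrum_le (R := ℝ) hT).1 hT.le_algebraMap_norm_self

/-- The kernel defining the projection is invariant under both `U` and `star U`, hence reduces `U`.
-/
lemma commute_spectralProj {T U : K →L[ℂ] K} (hU : Commute T U) (hU' : Commute T (star U))
    (t : ℝ) : Commute U (spectralProj T t) := by
  set W := (cfc (fun s : ℝ => max (s - t) 0) T).ker with hW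
  have hmem : ∀ S : K →L[ℂ] K, Commute T S → ∀ f ∈ W, S f ∈ W := by
    intro S hS f hf
    have hf' : cfc (fun s : ℝ => max (s - t) 0) T f = 0 := hf
    have h1 : cfc (fun s : ℝ => max (s - t) 0) T (S f) =
        S (cfc (fun s : ℝ => max (s - t) 0) T f) :=
      DFunLike.congr_fun (hS.cfc_real fun s : ℝ => max (s - t) 0) f
    rw [hf', map_zero] at h1
    exact h1
  ext1 f
  change U (W.starProjection f) = W.starProjection (U f)
  refine Submodule.eq_starProjection_of_mem_orthogonal
    (hmem U hU _ (Submodule.starProjection_apply_mem _ _)) ?_ |>.symm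
  rw [← map_sub, Submodule.mem_orthogonal']
  intro u hu
  rw [← ContinuousLinearMap.adjoint_inner_right]
  exact (Submodule.mem_orthogonal' _ _).1 (Submodule.sub_starProjection_mem_orthogonal f) _
    (hmem _ hU' u hu)

/-- Only the sign and the zero set of `D` matter, so one statement serves the trace density and the
finite volume densities. -/
lemma isLeast_distSupport {T : K →L[ℂ] K} (hT : IsSelfAdjoint T) {D : ℝ → ℝ}
    (hD : ∀ t, 0 ≤ D t) (hD' : ∀ t, D t = 0 ↔ spectralProj T t = 0) {m : ℝ}
    (hm : IsGreatest {t : ℝ | ∀ f, t * ‖f‖ ^ 2 ≤ T.reApplyInnerSelf f} m) :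
    IsLeast (distSupport D) m := by
  have hzero : ∀ t < m, D t = 0 := fun t ht =>
    (hD' t).2 (spectralProj_eq_zero_of_lt hT hm.1 ht)
  constructor
  · intro ε hε
    rw [hzero _ (by linarith)]
    refine (hD _).lt_of_ne fun h => ?_
    have := hm.2 (le_reApplyInnerSelf_of_spectralProj_eq_zero hT ((hD' _).1 h.symm))
    linarith
  · intro t ht
    by_contra! hlt
    -- This `ε` keeps `t + ε` below `m`, so `D` vanishes at both ends.
    have := ht ((m - t) / 2) (by linarith)
    rw [hzero _ (by linarith), hzero _ (by linarith)] at this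
    exact this.false

lemma norm_le_of_abs_reApplyInnerSelf_le {T : K →L[ℂ] K} (hT : IsSelfAdjoint T) {M : ℝ}
    (hM : 0 ≤ M) (h : ∀ f, |T.reApplyInnerSelf f| ≤ M * ‖f‖ ^ 2) : ‖T‖ ≤ M := by
  rw [T.norm_eq_iSup_rayleighQuotient hT.isSymmetric]
  refine ciSup_le fun f => ?_
  rw [ContinuousLinearMap.rayleighQuotient, abs_div, abs_of_nonneg (sq_nonneg ‖f‖)]
  exact div_le_of_le_mul₀ (sq_nonneg _) hM (h f)

end Hilbert

/-! ### The trace representation -/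

variable {V : Type*}

lemma hasSum_smul_delta (f : Ell2 V) : HasSum (fun v => f v • delta v) f := by
  classical
  have h := lp.hasSum_single (p := 2) (by norm_num) f
  refine h.congr_fun fun v => ?_
  rw [delta, ← lp.single_smul]
  simp

lemma delta_inner (v : V) (f : Ell2 V) : ⟪delta v, f⟫_ℂ = f v := by
  classical
  have h := lp.inner_single_left (𝕜 := ℂ) (G := fun _ : V => ℂ) v (1 : ℂ) f
  simp only [RCLike.inner_apply, map_one, mul_one] at h
  exact h

lemma norm_delta (v : V) : ‖delta v‖ = 1 := by
  classical
  simp [delta, lp.norm_single]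

lemma lam_delta {X : SimpleGraph V} (γ : X ≃g X) (v : V) : lam γ (delta v) = delta (γ v) := by
  classical
  ext w
  rw [lam_apply]
  simp only [delta, lp.single_apply, Pi.single_apply]
  congr 1
  exact propext (Equiv.symm_apply_eq γ.toEquiv)

/-- The translates of `δ_x`, `x ∈ F`, are all the basis vectors, so the family `(δ_x)` is separating
for the commutant of `λ(Γ)`. -/
lemma IsFundamentalDomain.eq_zero {X : SimpleGraph V} {Γ : Subgroup (X ≃g X)} {F : Finset V}
    (hF : IsFundamentalDomain Γ F) {T : Ell2 V →L[ℂ] Ell2 V} (hT : T ∈ (vN Γ).toStarSubalgebra)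
    (h : ∀ x ∈ F, T (delta x) = 0) : T = 0 := by
  have hv : ∀ v, T (delta v) = 0 := by
    intro v
    obtain ⟨x, ⟨hx, γ, hγ, rfl⟩, -⟩ := hF v
    rw [← lam_delta]
    have h1 := DFunLike.congr_fun (mem_vN.1 hT γ hγ) (delta x)
    exact h1.symm.trans (by simp [h x hx])
  ext1 f
  have h1 := (hasSum_smul_delta f).mapL T
  simp only [map_smul, hv, smul_zero] at h1
  exact h1.unique hasSum_zero

lemma diagSum_star_mul_self (F : Finset V) (T : Ell2 V →L[ℂ] Ell2 V) :
    diagSum F (star T * T) = ((∑ x ∈ F, ‖T (delta x)‖ ^ 2 : ℝ) : ℂ) := by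
  rw [diagSum, Complex.ofReal_sum]
  refine Finset.sum_congr rfl fun x _ => ?_
  change ⟪delta x, ContinuousLinearMap.adjoint T (T (delta x))⟫_ℂ = _
  rw [ContinuousLinearMap.adjoint_inner_right, inner_self_eq_norm_sq_to_K]
  simp

lemma IsFundamentalDomain.diagSum_faithful {X : SimpleGraph V} {Γ : Subgroup (X ≃g X)}
    {F : Finset V} (hF : IsFundamentalDomain Γ F) {T : Ell2 V →L[ℂ] Ell2 V}
    (hT : T ∈ (vN Γ).toStarSubalgebra) (h : diagSum F (star T * T) = 0) : T = 0 := by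
  rw [diagSum_star_mul_self, Complex.ofReal_eq_zero,
    Finset.sum_eq_zero_iff_of_nonneg fun _ _ => sq_nonneg _] at h
  exact hF.eq_zero hT fun x hx => by simpa using h x hx

lemma IsFundamentalDomain.traceRep_injective {X : SimpleGraph V} {Γ : Subgroup (X ≃g X)}
    {F : Finset V} (hF : IsFundamentalDomain Γ F) : Function.Injective (traceRep Γ F) := by
  rw [injective_iff_map_eq_zero]
  intro a ha
  -- Evaluate `π(a) = 0` at the class of `1`: the squared norm of the result is `Tr_Γ(a* a)`.
  have h1 : (trace Γ F).gnsNonUnitalStarAlgHom a ((trace Γ F).toPreGNS 1 : (trace Γ F).GNS) = 0 :=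
    DFunLike.congr_fun ha _
  rw [PositiveLinearMap.gnsNonUnitalStarAlgHom_apply_coe, ← norm_eq_zero,
    UniformSpace.Completion.norm_coe, ← sq_eq_zero_iff, ← Complex.ofReal_eq_zero,
    Complex.ofReal_pow, PositiveLinearMap.preGNS_norm_sq] at h1
  simp only [PositiveLinearMap.leftMulMapPreGNS_apply, PositiveLinearMap.ofPreGNS_toPreGNS,
    mul_one] at h1
  exact Subtype.ext (hF.diagSum_faithful a.2 h1)

/-! ### The norm of the adjacency operator -/

lemma isSelfAdjoint_adjOp {X : SimpleGraph V} (hX : BoundedDegree X) :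
    IsSelfAdjoint (adjOp X hX) := by
  have hmat : ∀ v w, adjOp X hX (delta w) v = adjEntry X v w := by
    classical
    intro v w
    rw [adjOp_apply, tsum_eq_single w fun u hu => by simp [delta, lp.single_apply, hu]]
    simp [delta, lp.single_apply]
  have hsymm : ∀ v w, adjEntry X v w = adjEntry X w v := fun v w => by
    classical
    exact if_congr (X.adj_comm v w) rfl rfl
  have hreal : ∀ v w, star (adjEntry X v w) = adjEntry X v w := fun v w => by
    unfold adjEntry; split_ifs <;> simp
  rw [ContinuousLinearMap.isSelfAdjoint_iff', eq_comm]
  ext1 f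
  have h1 := (hasSum_smul_delta f).mapL (adjOp X hX)
  refine h1.unique ?_
  -- It suffices to compare `A` and its adjoint on basis vectors, where the matrix is real and
  -- symmetric.
  convert (hasSum_smul_delta f).mapL (ContinuousLinearMap.adjoint (adjOp X hX)) using 2 with v
  simp only [map_smul]
  congr 1
  ext w
  rw [← delta_inner w (ContinuousLinearMap.adjoint _ _), ContinuousLinearMap.adjoint_inner_right,
    ← inner_conj_symm, delta_inner, hmat, hmat, hsymm v w]
  exact (hreal w v).symm

/-- The pointwise absolute value of an element of `ℓ²(V)`. -/
def absVal (f : Ell2 V) : Ell2 V :=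
  ⟨fun v => (‖f v‖ : ℂ), memlp_of_sum_le (C := ‖f‖ ^ 2) fun s => by
    simp only [Complex.norm_real, norm_norm]
    rw [norm_sq_eq_tsum]
    exact (summable_norm_sq f).sum_le_tsum _ fun _ _ => by positivity⟩

lemma absVal_apply (f : Ell2 V) (v : V) : absVal f v = (‖f v‖ : ℂ) := rfl

lemma norm_absVal (f : Ell2 V) : ‖absVal f‖ = ‖f‖ := by
  refine (sq_eq_sq₀ (norm_nonneg _) (norm_nonneg _)).1 ?_
  simp [norm_sq_eq_tsum, absVal_apply]

lemma adjOp_absVal_apply {X : SimpleGraph V} (hX : BoundedDegree X) (f : Ell2 V) (v : V) :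
    adjOp X hX (absVal f) v = ((∑ w ∈ (hX.finite v).toFinset, ‖f w‖ : ℝ) : ℂ) := by
  refine (adjApply_eq hX _ v).trans ?_
  simp [absVal_apply]

/-- The triangle inequality at each vertex, possible because the matrix entries are nonnegative. -/
lemma abs_reApplyInnerSelf_adjOp_le {X : SimpleGraph V} (hX : BoundedDegree X) (f : Ell2 V) :
    |(adjOp X hX).reApplyInnerSelf f| ≤ (adjOp X hX).reApplyInnerSelf (absVal f) := by
  have hle : ∀ v, ‖⟪adjOp X hX f v, f v⟫_ℂ‖ ≤
      (⟪adjOp X hX (absVal f) v, absVal f v⟫_ℂ).re := by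
    intro v
    rw [adjOp_absVal_apply, absVal_apply, RCLike.inner_apply, RCLike.inner_apply,
      Complex.conj_ofReal, ← Complex.ofReal_mul, Complex.ofReal_re, norm_mul, RCLike.norm_conj]
    gcongr
    exact (congrArg _ (adjApply_eq hX f v)).trans_le (norm_sum_le _ _)
  have h1 : HasSum (fun v => ⟪adjOp X hX f v, f v⟫_ℂ) ⟪adjOp X hX f, f⟫_ℂ := lp.hasSum_inner _ _
  have h2 : HasSum (fun v => ⟪adjOp X hX (absVal f) v, absVal f v⟫_ℂ)
    ⟪adjOp X hX (absVal f), absVal f⟫_ℂ := lp.hasSum_inner _ _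
  exact (Complex.abs_re_le_norm _).trans (h1.norm_le_of_bounded (Complex.hasSum_re h2) hle)

lemma norm_adjOp_le [Nonempty V] {X : SimpleGraph V} (hX : BoundedDegree X) {M : ℝ}
    (h : ∀ f, (adjOp X hX).reApplyInnerSelf f ≤ M * ‖f‖ ^ 2) : ‖adjOp X hX‖ ≤ M := by
  have habs : ∀ f, |(adjOp X hX).reApplyInnerSelf f| ≤ M * ‖f‖ ^ 2 := fun f =>
    (abs_reApplyInnerSelf_adjOp_le hX f).trans ((h _).trans_eq (by rw [norm_absVal]))
  refine norm_le_of_abs_reApplyInnerSelf_le (isSelfAdjoint_adjOp hX) ?_ habs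
  -- A unit vector forces `0 ≤ M`.
  have h1 := (abs_nonneg _).trans (habs (delta (Classical.arbitrary V)))
  simpa [norm_delta] using h1

lemma isLUB_spectrum_adjOp [Nonempty V] {X : SimpleGraph V} (hX : BoundedDegree X) :
    IsLUB (spectrum ℝ (adjOp X hX)) ‖adjOp X hX‖ := by
  have hA := isSelfAdjoint_adjOp hX
  exact ⟨norm_mem_upperBounds_spectrum hA,
    fun M hM => norm_adjOp_le hX ((mem_upperBounds_spectrum_iff hA).1 hM)⟩

/-- Injective star homomorphisms preserve the spectrum of a self-adjoint element; this is used for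
`π` and for the inclusion of `N(X, Γ)` in all bounded operators. -/
lemma spectrum_traceRep_adjN {X : SimpleGraph V} (hX : BoundedDegree X) {Γ : Subgroup (X ≃g X)}
    {F : Finset V} (hF : IsFundamentalDomain Γ F) :
    spectrum ℝ (traceRep Γ F (adjN hX Γ)) = spectrum ℝ (adjOp X hX) := by
  have hA : IsSelfAdjoint (adjN hX Γ) := Subtype.ext (isSelfAdjoint_adjOp hX)
  rw [hA.map_spectrum_real (traceRep Γ F) hF.traceRep_injective]
  exact (hA.map_spectrum_real (vN Γ).toStarSubalgebra.subtype Subtype.val_injective).symm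

lemma norm_traceRep {X : SimpleGraph V} {Γ : Subgroup (X ≃g X)}
    {F : Finset V} (hF : IsFundamentalDomain Γ F) (T : N Γ) :
    ‖traceRep Γ F T‖ = ‖(T : Ell2 V →L[ℂ] Ell2 V)‖ :=
  NonUnitalStarAlgHom.norm_map (traceRep Γ F) hF.traceRep_injective T

/-! ### Absence of hidden spectrum -/

lemma spectralProj_mem_vN {X : SimpleGraph V} {Γ : Subgroup (X ≃g X)}
    {T : Ell2 V →L[ℂ] Ell2 V} (hT : T ∈ (vN Γ).toStarSubalgebra) (t : ℝ) :
    spectralProj T t ∈ (vN Γ).toStarSubalgebra := by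
  rw [mem_vN]
  intro γ hγ
  refine commute_spectralProj (mem_vN.1 hT γ hγ).symm ?_ t
  rw [star_lam]
  exact (mem_vN.1 hT γ⁻¹ (Γ.inv_mem hγ)).symm

lemma diagSum_spectralProj (F : Finset V) (T : Ell2 V →L[ℂ] Ell2 V) (t : ℝ) :
    diagSum F (spectralProj T t) =
      diagSum F (star (spectralProj T t) * spectralProj T t) := by
  have h : IsStarProjection (spectralProj T t) := isStarProjection_starProjection
  rw [h.isSelfAdjoint.star_eq, h.isIdempotentElem.eq]

lemma density_nonneg (F : Finset V) (T : Ell2 V →L[ℂ] Ell2 V) (t : ℝ) : 0 ≤ density F T t := by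
  rw [density, diagSum_spectralProj, diagSum_star_mul_self, Complex.ofReal_re]
  positivity

lemma density_eq_zero_iff {X : SimpleGraph V} {Γ : Subgroup (X ≃g X)} {F : Finset V}
    (hF : IsFundamentalDomain Γ F) {T : Ell2 V →L[ℂ] Ell2 V}
    (hT : T ∈ (vN Γ).toStarSubalgebra) (t : ℝ) :
    density F T t = 0 ↔ spectralProj T t = 0 := by
  refine ⟨fun h => hF.diagSum_faithful (spectralProj_mem_vN hT t) ?_, fun h => ?_⟩
  · rw [density, diagSum_spectralProj, diagSum_star_mul_self, Complex.ofReal_re] at h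
    rw [diagSum_star_mul_self, h, Complex.ofReal_zero]
  · simp [density, diagSum, h]

lemma incl_apply (Λ : Finset V) (g : EuclideanSpace ℂ Λ) :
    incl Λ g = ∑ x : Λ, g x • delta (x : V) := by
  simp [incl]

lemma norm_incl_sq (Λ : Finset V) (g : EuclideanSpace ℂ Λ) : ‖incl Λ g‖ ^ 2 = ‖g‖ ^ 2 := by
  classical
  have hon : Orthonormal ℂ fun x : Λ => delta (x : V) := by
    rw [orthonormal_iff_ite]
    intro x y
    rw [delta_inner, delta, lp.single_apply, Pi.single_apply]
    exact if_congr Subtype.ext_iff.symm rfl rfl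
  rw [EuclideanSpace.norm_sq_eq, incl_apply, ← Complex.ofReal_inj, Complex.ofReal_pow]
  have h1 := inner_self_eq_norm_sq_to_K (𝕜 := ℂ) (∑ x : Λ, g x • delta (x : V))
  rw [hon.inner_sum] at h1
  refine h1.symm.trans ?_
  simp [RCLike.conj_mul]

lemma truncation_reApplyInnerSelf (T : Ell2 V →L[ℂ] Ell2 V) (Λ : Finset V)
    (g : EuclideanSpace ℂ Λ) :
    (truncation T Λ).reApplyInnerSelf g = T.reApplyInnerSelf (incl Λ g) := by
  simp [ContinuousLinearMap.reApplyInnerSelf_apply, truncation,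
    ContinuousLinearMap.adjoint_inner_left]

lemma isSelfAdjoint_truncation {T : Ell2 V →L[ℂ] Ell2 V} (hT : IsSelfAdjoint T) (Λ : Finset V) :
    IsSelfAdjoint (truncation T Λ) :=
  hT.adjoint_conj (incl Λ)

lemma finiteDensity_nonneg (T : Ell2 V →L[ℂ] Ell2 V) (Λ : Finset V) (t : ℝ) :
    0 ≤ finiteDensity T Λ t := by
  have h : IsStarProjection (spectralProj (truncation T Λ) t) := isStarProjection_starProjection
  have h1 := LinearMap.IsPositive.trace_nonneg
    ((ContinuousLinearMap.isPositive_toLinearMap_iff _).2 (.of_isStarProjection h))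
  exact div_nonneg (Complex.nonneg_iff.1 h1).1 (Nat.cast_nonneg _)

lemma finiteDensity_eq_zero_iff (T : Ell2 V →L[ℂ] Ell2 V) {Λ : Finset V} (hΛ : Λ.Nonempty)
    (t : ℝ) : finiteDensity T Λ t = 0 ↔ spectralProj (truncation T Λ) t = 0 := by
  have h : IsStarProjection (spectralProj (truncation T Λ) t) := isStarProjection_starProjection
  have h1 := LinearMap.IsPositive.trace_nonneg
    ((ContinuousLinearMap.isPositive_toLinearMap_iff _).2 (.of_isStarProjection h))
  have h2 : IsIdempotentElem (spectralProj (truncation T Λ) t).toLinearMap :=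
    congrArg ContinuousLinearMap.toLinearMap h.isIdempotentElem
  have h3 : (Λ.card : ℝ) ≠ 0 := by exact_mod_cast hΛ.card_ne_zero
  rw [finiteDensity, div_eq_zero_iff, or_iff_left h3]
  refine ⟨fun h0 => ?_, fun h0 => by simp [h0]⟩
  have h4 : LinearMap.trace ℂ _ (spectralProj (truncation T Λ) t).toLinearMap = 0 :=
    Complex.ext h0 (Complex.nonneg_iff.1 h1).2.symm
  exact ContinuousLinearMap.coe_injective ((LinearMap.IsIdempotentElem.trace_eq_zero_iff h2).1 h4)

lemma tendsto_incl {X : SimpleGraph V} {Λ : ℕ → Finset V} (hΛ : IsAmenableExhaustion X Λ)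
    (f : Ell2 V) :
    Tendsto (fun n => incl (Λ n) (WithLp.toLp 2 fun x : Λ n => f x)) atTop (𝓝 f) := by
  refine ((hasSum_smul_delta f).comp
    (tendsto_atTop_finset_of_monotone hΛ.mono hΛ.exhausts)).congr fun n => ?_
  rw [incl_apply]
  exact (Finset.sum_coe_sort (Λ n) fun v => f v • delta v).symm

lemma noHiddenSpectrum [Infinite V] {X : SimpleGraph V} {Γ : Subgroup (X ≃g X)}
    {F : Finset V} (hF : IsFundamentalDomain Γ F) {Λ : ℕ → Finset V}
    (hΛ : IsAmenableExhaustion X Λ) {T : Ell2 V →L[ℂ] Ell2 V} (hT : IsSelfAdjoint T)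
    (hTN : T ∈ (vN Γ).toStarSubalgebra) : NoHiddenSpectrum F Λ T := by
  have hV : Nontrivial (Ell2 V) := by
    refine ⟨delta (Classical.arbitrary V), 0, fun h => ?_⟩
    simpa [h] using norm_delta (Classical.arbitrary V)
  obtain ⟨m, hm⟩ := exists_isGreatest_lowerBound T
  refine ⟨m, ?_, (isLeast_distSupport hT (density_nonneg F T)
    (density_eq_zero_iff hF hTN) hm).isGLB⟩
  -- An empty `Λ n` has density `0 / 0 = 0`, whose support is empty, so early terms must be
  -- discarded.
  have hne : ∀ᶠ n in atTop, (Λ n).Nonempty := by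
    obtain ⟨n, hn⟩ := hΛ.exhausts (Classical.arbitrary V)
    exact (eventually_ge_atTop n).mono fun k hk => ⟨_, hΛ.mono hk hn⟩
  have hgreat : ∀ᶠ n in atTop,
      IsGreatest {t : ℝ | ∀ g, t * ‖g‖ ^ 2 ≤ (truncation T (Λ n)).reApplyInnerSelf g}
        (sInf (distSupport (finiteDensity T (Λ n)))) := by
    filter_upwards [hne] with n hn
    have : Nonempty (Λ n) := hn.to_subtype
    obtain ⟨k, hk⟩ := exists_isGreatest_lowerBound (truncation T (Λ n))
    rwa [(isLeast_distSupport (isSelfAdjoint_truncation hT _) (finiteDensity_nonneg T (Λ n))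
      (finiteDensity_eq_zero_iff T hn) hk).csInf_eq]
  rw [tendsto_order]
  constructor
  · intro a ha
    filter_upwards [hgreat] with n hn
    -- `m` bounds the restricted form from below, so no truncation has its bottom below `m`.
    refine ha.trans_le (hn.2 fun g => ?_)
    rw [truncation_reApplyInnerSelf, ← norm_incl_sq]
    exact hm.1 _
  · intro a ha
    -- Since `a > m`, some `f` has form value below `a ‖f‖²`; by continuity its cut-offs to `Λ n`
    -- eventually do too.
    have h1 : ¬ ∀ f, a * ‖f‖ ^ 2 ≤ T.reApplyInnerSelf f := fun h => ha.not_ge (hm.2 h)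
    push Not at h1
    obtain ⟨f, hf⟩ := h1
    have hc : Continuous fun g : Ell2 V => T.reApplyInnerSelf g := T.reApplyInnerSelf_continuous
    have hlim := (hc.tendsto f).comp (tendsto_incl hΛ f)
    have hlim' := ((tendsto_incl hΛ f).norm.pow 2).const_mul a
    filter_upwards [hgreat, hlim.eventually_lt hlim' hf] with n hn hlt
    rw [Function.comp_apply, ← truncation_reApplyInnerSelf, norm_incl_sq] at hlt
    by_contra! hle
    have h2 := hn.1 (WithLp.toLp 2 fun x : Λ n => f x)
    have h3 := mul_le_mul_of_nonneg_right hle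
      (sq_nonneg ‖(WithLp.toLp 2 fun x : Λ n => f x : EuclideanSpace ℂ (Λ n))‖)
    linarith

end PeriodicGraph

end

theorem mainTheorem6 {V : Type*} [Countable V] [Infinite V]
    (X : SimpleGraph V) (hX : PeriodicGraph.BoundedDegree X)
    (Γ : Subgroup (X ≃g X)) (hΓ : PeriodicGraph.IsAmenableGroup Γ)
    (hfree : PeriodicGraph.ActsFreely Γ)
    (F : Finset V) (hF : PeriodicGraph.IsFundamentalDomain Γ F) :
    IsLUB (spectrum ℝ (PeriodicGraph.traceRep Γ F (PeriodicGraph.adjN hX Γ)))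
      ‖PeriodicGraph.adjOp X hX‖ ∧
    ‖PeriodicGraph.traceRep Γ F (PeriodicGraph.adjN hX Γ)‖ = ‖PeriodicGraph.adjOp X hX‖ ∧
    ∀ Λ : ℕ → Finset V, PeriodicGraph.IsAmenableExhaustion X Λ →
      PeriodicGraph.NoHiddenSpectrum F Λ
        ((‖PeriodicGraph.adjOp X hX‖ : ℂ) • (1 : PeriodicGraph.Ell2 V →L[ℂ] PeriodicGraph.Ell2 V)
          - PeriodicGraph.adjOp X hX) := by
  refine ⟨?_, PeriodicGraph.norm_traceRep hF _, fun Λ hΛ => ?_⟩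
  · rw [PeriodicGraph.spectrum_traceRep_adjN hX hF]
    exact PeriodicGraph.isLUB_spectrum_adjOp hX
  · refine PeriodicGraph.noHiddenSpectrum hF hΛ ?_ ?_
    · refine IsSelfAdjoint.sub ?_ (PeriodicGraph.isSelfAdjoint_adjOp hX)
      exact IsSelfAdjoint.smul (Complex.conj_ofReal _) (.one _)
    · exact sub_mem (SMulMemClass.smul_mem _ (one_mem _)) (PeriodicGraph.adjOp_mem hX Γ)
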